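/- Let $P$ be an arbitrary set (of "letters"). Let $\mathcal{DS}^{co}$ be the cocartesian monoidal comonad freely generated by $P$, i.e. the free category with (chosen) finite coproducts and a comonad $\langle L,\varepsilon,\delta\rangle$ in it. Explicitly: its objects are the formulae built from the letters in $P$ and the constant $I$ with the binary operation $\otimes$ and the unary operation $L$; its arrows are the arrow terms built from identities, composition, $!_A\colon I\to A$, the injections $\iota^1_{A,B}\colon A\to A\otimes B$ and $\iota^2_{A,B}\colon B\to A\otimes B$, copairing $[f,g]\colon A\otimes B\to C$ (for $f\colon A\to C$, $g\colon B\to C$), $Lf\colon LA\to LB$ (for $f\colon A\to B$), $\varepsilon_A\colon LA\to A$ and $\delta_A\colon LA\to LLA$, modulo the least congruence satisfying the equations that say that we have a category in which $I$ is initial, $A\otimes B$ is a coproduct of $A$ and $B$ with injections $\iota^1_{A,B},\iota^2_{A,B}$ and copairing $[\,\cdot\,,\cdot\,]$, and $\langle L,\varepsilon,\delta\rangle$ is a comonad. The arrows $\nabla_A=[\mathbf 1_A,\mathbf 1_A]$, $f\otimes g=[\iota^1\circ f,\iota^2\circ g]$, the associativity, unit and symmetry isomorphisms, $\psi_{A,B}=\nabla_{L(A\otimes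 B)}\circ(L\iota^1_{A,B}\otimes L\iota^2_{A,B})\colon LA\otimes LB\to L(A\otimes B)$ and $\psi_0={!}_{LI}\colon I\to LI$ are defined canonically. Let $\mathit{Rel}$ be the category whose objects are the finite ordinals and whose arrows are arbitrary binary relations between them. Let $G\colon\mathcal{DS}^{co}\to\mathit{Rel}$ be the functor such that $GA$ is the number of occurrences of letters in $A$ plus the number of occurrences of $L$ in $A$ (the elements of $GA$ are identified with these occurrences, numbered from right to left, so that in $LA$ the outermost $L$ has the number $GA$), and - $G\,!_A$ is the empty relation from $\emptyset$ to $GA$; - $G\iota^1_{A,B}$ and $G\iota^2_{A,B}$ join each occurrence in $A$, respectively $B$, with the corresponding occurrence in $A\otimes B$; - $G[f,g]$ is $Gf$ on the occurrences in $A$ and $Gg$ on the occurrences in $B$ (hence $G\nabla_A$ joins both copies of each occurrence in $A\otimes A$ with that occurrence in $A$); - $G(Lf)$ is $Gf$ together with one pair joining the two outermost occurrences of $L$; - $G\varepsilon_A$ joins each occurrence in $A$ with itself, and the outermost $L$ of $LA$ with nothing; - $G\delta_A$ joins each occurrence in $A$ with itself, and the outermost $L$ of $LA$ with both of the two outermost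 occurrences of $L$ in $LLA$. (It follows that $G\psi_{A,B}$ joins both outermost occurrences of $L$ in $LA\otimes LB$ with the outermost $L$ of $L(A\otimes B)$ and every other occurrence with itself, and that $G\psi_0$ is the empty relation from $\emptyset$ to $1$.) Then $G$ is faithful: for all arrows $f,g\colon A\to B$ of $\mathcal{DS}^{co}$, if $Gf=Gg$, then $f=g$. -/

import Mathlib

open CategoryTheory

universe u

/-! ## The category `Rel` of relations between finite ordinals -/

/-- Objects of `Rel`: finite ordinals `n = {0, …, n-1}`. -/
structure FinOrdRel where
  card : ℕ

/-- Arrows of `Rel` are arbitrary relations between finite ordinals; composition is composition of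
relations (`f ≫ g` is first `f`, then `g`). -/
instance FinOrdRel.category : Category FinOrdRel where
  Hom m n := SetRel (Fin m.card) (Fin n.card)
  id _ := SetRel.id
  comp R S := SetRel.comp R S
  id_comp R := SetRel.id_comp R
  comp_id R := SetRel.comp_id R
  assoc R S T := SetRel.comp_assoc R S T

/-! ## The free cocartesian category with a comonad -/

/-- Objects of the cocartesian monoidal comonad freely generated by the set `P` of objects:
propositional formulae built from the letters in `P` with `I`, `⊗` and `L`. -/
inductive DSco (P : Type u) : Type u
  | letter (p : P) : DSco P
  | I : DSco P
  | tensor (A B : DSco P) : DSco P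
  | L (A : DSco P) : DSco P

namespace DSco

variable {P : Type u}

/-- Arrow terms: the operations of a category with a (chosen) initial object `I`, (chosen) binary
coproducts `A ⊗ B`, an endofunctor `L`, and the arrows `ε_A`, `δ_A`.
`comp f g` is first `f`, then `g`. -/
inductive Term : DSco P → DSco P → Type u
  | id (A : DSco P) : Term A A
  | comp {A B C : DSco P} (f : Term A B) (g : Term B C) : Term A C
  | bang (A : DSco P) : Term I A
  | inl (A B : DSco P) : Term A (tensor A B)
  | inr (A B : DSco P) : Term B (tensor A B)
  | copair {A B C : DSco P} (f : Term A C) (g : Term B C) : Term (tensor A B) C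
  | map {A B : DSco P} (f : Term A B) : Term (L A) (L B)
  | eps (A : DSco P) : Term (L A) A
  | delta (A : DSco P) : Term (L A) (L (L A))

/-- Equality of arrow terms: the least congruence satisfying the equations of a category with
finite coproducts and of a comonad `⟨L, ε, δ⟩` in it. -/
inductive Term.Eqv : {A B : DSco P} → Term A B → Term A B → Prop
  -- equivalence relation and congruence
  | refl {A B : DSco P} (f : Term A B) : Eqv f f
  | symm {A B : DSco P} {f g : Term A B} : Eqv f g → Eqv g f
  | trans {A B : DSco P} {f g h : Term A B} : Eqv f g → Eqv g h → Eqv f h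
  | comp_congr {A B C : DSco P} {f f' : Term A B} {g g' : Term B C} :
      Eqv f f' → Eqv g g' → Eqv (f.comp g) (f'.comp g')
  | copair_congr {A B C : DSco P} {f f' : Term A C} {g g' : Term B C} :
      Eqv f f' → Eqv g g' → Eqv (f.copair g) (f'.copair g')
  | map_congr {A B : DSco P} {f f' : Term A B} : Eqv f f' → Eqv f.map f'.map
  -- category
  | id_comp {A B : DSco P} (f : Term A B) : Eqv ((Term.id A).comp f) f
  | comp_id {A B : DSco P} (f : Term A B) : Eqv (f.comp (Term.id B)) f
  | assoc {A B C D : DSco P} (f : Term A B) (g : Term B C) (h : Term C D) :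
      Eqv ((f.comp g).comp h) (f.comp (g.comp h))
  -- `I` is initial
  | bang_uniq {A : DSco P} (f : Term I A) : Eqv f (Term.bang A)
  -- `A ⊗ B` is a coproduct of `A` and `B`
  | inl_copair {A B C : DSco P} (f : Term A C) (g : Term B C) :
      Eqv ((Term.inl A B).comp (f.copair g)) f
  | inr_copair {A B C : DSco P} (f : Term A C) (g : Term B C) :
      Eqv ((Term.inr A B).comp (f.copair g)) g
  | copair_eta {A B C : DSco P} (h : Term (tensor A B) C) :
      Eqv (((Term.inl A B).comp h).copair ((Term.inr A B).comp h)) h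
  -- `L` is a functor
  | map_id (A : DSco P) : Eqv (Term.id A).map (Term.id (L A))
  | map_comp {A B C : DSco P} (f : Term A B) (g : Term B C) :
      Eqv (f.comp g).map (f.map.comp g.map)
  -- `ε` and `δ` are natural
  | eps_nat {A B : DSco P} (f : Term A B) :
      Eqv (f.map.comp (Term.eps B)) ((Term.eps A).comp f)
  | delta_nat {A B : DSco P} (f : Term A B) :
      Eqv (f.map.comp (Term.delta B)) ((Term.delta A).comp f.map.map)
  -- comonad equations
  | delta_eps (A : DSco P) : Eqv ((Term.delta A).comp (Term.eps (L A))) (Term.id (L A))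
  | delta_map_eps (A : DSco P) : Eqv ((Term.delta A).comp (Term.eps A).map) (Term.id (L A))
  | delta_delta (A : DSco P) :
      Eqv ((Term.delta A).comp (Term.delta (L A))) ((Term.delta A).comp (Term.delta A).map)

instance Term.setoid (A B : DSco P) : Setoid (Term A B) where
  r := Term.Eqv
  iseqv := ⟨Term.Eqv.refl, Term.Eqv.symm, Term.Eqv.trans⟩

/-- The category `DS^co`: its arrows are the arrow terms modulo the equations. -/
instance category : Category.{u} (DSco P) where
  Hom A B := Quotient (Term.setoid A B)
  id A := ⟦Term.id A⟧
  comp := Quotient.map₂ Term.comp fun _ _ hf _ _ hg => Term.Eqv.comp_congr hf hg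
  id_comp f := by
    induction f using Quotient.inductionOn with
    | h f => exact Quotient.sound (Term.Eqv.id_comp f)
  comp_id f := by
    induction f using Quotient.inductionOn with
    | h f => exact Quotient.sound (Term.Eqv.comp_id f)
  assoc f g h := by
    induction f using Quotient.inductionOn with
    | h f =>
      induction g using Quotient.inductionOn with
      | h g =>
        induction h using Quotient.inductionOn with
        | h h => exact Quotient.sound (Term.Eqv.assoc f g h)

/-! ### The structure of `DS^co`: finite coproducts, a comonad, and the derived arrows -/

/-- `!_A : I → A`. -/
def bang (A : DSco P) : (I : DSco P) ⟶ A := ⟦Term.bang A⟧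

/-- `ι¹ : A → A ⊗ B`. -/
def inl (A B : DSco P) : A ⟶ tensor A B := ⟦Term.inl A B⟧

/-- `ι² : B → A ⊗ B`. -/
def inr (A B : DSco P) : B ⟶ tensor A B := ⟦Term.inr A B⟧

/-- The copairing `[f, g] : A ⊗ B → C`. -/
def copair {A B C : DSco P} : (A ⟶ C) → (B ⟶ C) → (tensor A B ⟶ C) :=
  Quotient.map₂ Term.copair fun _ _ hf _ _ hg => Term.Eqv.copair_congr hf hg

theorem inl_copair {A B C : DSco P} (f : A ⟶ C) (g : B ⟶ C) : inl A B ≫ copair f g = f := by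
  induction f using Quotient.inductionOn with
  | h f =>
    induction g using Quotient.inductionOn with
    | h g => exact Quotient.sound (Term.Eqv.inl_copair f g)

theorem inr_copair {A B C : DSco P} (f : A ⟶ C) (g : B ⟶ C) : inr A B ≫ copair f g = g := by
  induction f using Quotient.inductionOn with
  | h f =>
    induction g using Quotient.inductionOn with
    | h g => exact Quotient.sound (Term.Eqv.inr_copair f g)

theorem copair_eta {A B C : DSco P} (h : tensor A B ⟶ C) :
    copair (inl A B ≫ h) (inr A B ≫ h) = h := by
  induction h using Quotient.inductionOn with
  | h h => exact Quotient.sound (Term.Eqv.copair_eta h)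

/-- `I` is an initial object. -/
def isInitialI : Limits.IsInitial (I : DSco P) :=
  Limits.IsInitial.ofUniqueHom bang fun A f => by
    induction f using Quotient.inductionOn with
    | h f => exact Quotient.sound (Term.Eqv.bang_uniq f)

/-- `A ⊗ B` is a coproduct of `A` and `B`. -/
def isColimitTensor (A B : DSco P) :
    Limits.IsColimit (Limits.BinaryCofan.mk (inl A B) (inr A B)) :=
  Limits.BinaryCofan.IsColimit.mk _ (fun f g => copair f g)
    (fun f g => inl_copair f g) (fun f g => inr_copair f g)
    (fun f g m hf hg => by
      rw [← copair_eta m]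
      exact congrArg₂ copair hf hg)

/-- `L f : L A → L B`. -/
def mapL {A B : DSco P} : (A ⟶ B) → (L A ⟶ L B) :=
  Quotient.map Term.map fun _ _ hf => Term.Eqv.map_congr hf

/-- `ε_A : L A → A`. -/
def eps (A : DSco P) : L A ⟶ A := ⟦Term.eps A⟧

/-- `δ_A : L A → L (L A)`. -/
def delta (A : DSco P) : L A ⟶ L (L A) := ⟦Term.delta A⟧

/-- The comonad `⟨L, ε, δ⟩` in `DS^co`. -/
def comonad (P : Type u) : Comonad (DSco P) where
  obj A := L A
  map := mapL
  map_id A := Quotient.sound (Term.Eqv.map_id A)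
  map_comp f g := by
    induction f using Quotient.inductionOn with
    | h f =>
      induction g using Quotient.inductionOn with
      | h g => exact Quotient.sound (Term.Eqv.map_comp f g)
  ε :=
    { app := eps
      naturality := fun A B f => by
        induction f using Quotient.inductionOn with
        | h f => exact Quotient.sound (Term.Eqv.eps_nat f) }
  δ :=
    { app := delta
      naturality := fun A B f => by
        induction f using Quotient.inductionOn with
        | h f => exact Quotient.sound (Term.Eqv.delta_nat f) }
  coassoc A := Quotient.sound (Term.Eqv.delta_delta A).symm
  left_counit A := Quotient.sound (Term.Eqv.delta_eps A)
  right_counit A := Quotient.sound (Term.Eqv.delta_map_eps A)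

/-- `f ⊗ g : A ⊗ B → A' ⊗ B'`. -/
def tensorHom {A B A' B' : DSco P} (f : A ⟶ A') (g : B ⟶ B') : tensor A B ⟶ tensor A' B' :=
  copair (f ≫ inl A' B') (g ≫ inr A' B')

/-- `a_{A,B,C} : (A ⊗ B) ⊗ C → A ⊗ (B ⊗ C)`. -/
def assocHom (A B C : DSco P) : tensor (tensor A B) C ⟶ tensor A (tensor B C) :=
  copair (copair (inl A (tensor B C)) (inl B C ≫ inr A (tensor B C)))
    (inr B C ≫ inr A (tensor B C))

/-- `l_A : I ⊗ A → A`. -/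
def leftUnit (A : DSco P) : tensor I A ⟶ A := copair (bang A) (𝟙 A)

/-- `r_A : A ⊗ I → A`. -/
def rightUnit (A : DSco P) : tensor A I ⟶ A := copair (𝟙 A) (bang A)

/-- `c_{A,B} : A ⊗ B → B ⊗ A`. -/
def symmetry (A B : DSco P) : tensor A B ⟶ tensor B A := copair (inr B A) (inl B A)

/-- `∇_A : A ⊗ A → A`. -/
def codiag (A : DSco P) : tensor A A ⟶ A := copair (𝟙 A) (𝟙 A)

/-- `ψ_{A,B} = ∇_{L(A ⊗ B)} ∘ (L ι¹ ⊗ L ι²) : L A ⊗ L B → L (A ⊗ B)`. -/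
def psi (A B : DSco P) : tensor (L A) (L B) ⟶ L (tensor A B) :=
  tensorHom (mapL (inl A B)) (mapL (inr A B)) ≫ codiag (L (tensor A B))

/-- `ψ₀ = !_{L I} : I → L I`. -/
def psi₀ : (I : DSco P) ⟶ L I := bang (L I)

/-! ### The functor `G` -/

/-- `G A` on objects: the number of occurrences of letters in `A` plus the number of occurrences of
`L` in `A`. The occurrences are numbered from right to left: in `A ⊗ B` those of `B` come first,
followed by those of `A`, and in `L A` the outermost `L` has the last number, `G A`. -/
def occ : DSco P → ℕ
  | letter _ => 1
  | I => 0
  | tensor A B => occ B + occ A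
  | L A => occ A + 1

/-- The relation of the first injection `m → n + m`. -/
def relInl (m n : ℕ) : SetRel (Fin m) (Fin (n + m)) := {x | x.2 = Fin.natAdd n x.1}

/-- The relation of the second injection `n → n + m`. -/
def relInr (m n : ℕ) : SetRel (Fin n) (Fin (n + m)) := {x | x.2 = Fin.castAdd m x.1}

/-- Two relations with the same target put side by side: `R` on the left block, `S` on the right
block (whose elements have the smaller numbers). -/
def relCopair {m n k : ℕ} (R : SetRel (Fin m) (Fin k)) (S : SetRel (Fin n) (Fin k)) :
    SetRel (Fin (n + m)) (Fin k) :=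
  {x | (∃ i, x.1 = Fin.natAdd n i ∧ (i, x.2) ∈ R) ∨ (∃ i, x.1 = Fin.castAdd m i ∧ (i, x.2) ∈ S)}

/-- `G (L f)`: the relation `G f` with one line added, joining the outermost occurrences of `L`. -/
def relMap {m n : ℕ} (R : SetRel (Fin m) (Fin n)) : SetRel (Fin (m + 1)) (Fin (n + 1)) :=
  {x | (x.1 = Fin.last m ∧ x.2 = Fin.last n) ∨
    ∃ i j, x.1 = Fin.castSucc i ∧ x.2 = Fin.castSucc j ∧ (i, j) ∈ R}

/-- `G ε_A`: joins `i` with `i` for `i < G A`; the outermost `L` of `L A` is not joined. -/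
def relEps (n : ℕ) : SetRel (Fin (n + 1)) (Fin n) := {x | x.1.val = x.2.val}

/-- `G δ_A`: joins `i` with `i` for `i ≤ G A`, and moreover `G A` with `G A + 1`. -/
def relDelta (n : ℕ) : SetRel (Fin (n + 1)) (Fin (n + 1 + 1)) :=
  {x | x.1.val = x.2.val ∨ (x.1.val = n ∧ x.2.val = n + 1)}

/-- `G f` for an arrow term `f`. -/
def Term.graph : {A B : DSco P} → Term A B → SetRel (Fin (occ A)) (Fin (occ B))
  | _, _, .id _ => SetRel.id
  | _, _, .comp f g => SetRel.comp f.graph g.graph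
  | _, _, .bang _ => ∅
  | _, _, .inl A B => relInl (occ A) (occ B)
  | _, _, .inr A B => relInr (occ A) (occ B)
  | _, _, .copair f g => relCopair f.graph g.graph
  | _, _, .map f => relMap f.graph
  | _, _, .eps A => relEps (occ A)
  | _, _, .delta A => relDelta (occ A)

theorem relInl_copair {m n k : ℕ} (R : SetRel (Fin m) (Fin k)) (S : SetRel (Fin n) (Fin k)) :
    (relInl m n).comp (relCopair R S) = R := by
  ext ⟨i, z⟩
  simp only [SetRel.mem_comp, relInl, relCopair, Set.mem_ofPred_eq, Fin.ext_iff,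
    Fin.val_natAdd, Fin.val_castAdd]
  constructor
  · rintro ⟨b, hb, ⟨i', h, hR⟩ | ⟨i', h, -⟩⟩
    · have : i = i' := Fin.ext (by omega)
      exact this ▸ hR
    · omega
  · intro h
    exact ⟨Fin.natAdd n i, rfl, Or.inl ⟨i, rfl, h⟩⟩

theorem relInr_copair {m n k : ℕ} (R : SetRel (Fin m) (Fin k)) (S : SetRel (Fin n) (Fin k)) :
    (relInr m n).comp (relCopair R S) = S := by
  ext ⟨i, z⟩
  simp only [SetRel.mem_comp, relInr, relCopair, Set.mem_ofPred_eq, Fin.ext_iff,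
    Fin.val_natAdd, Fin.val_castAdd]
  constructor
  · rintro ⟨b, hb, ⟨i', h, -⟩ | ⟨i', h, hS⟩⟩
    · omega
    · have : i = i' := Fin.ext (by omega)
      exact this ▸ hS
  · intro h
    exact ⟨Fin.castAdd m i, rfl, Or.inr ⟨i, rfl, h⟩⟩

theorem relCopair_eta {m n k : ℕ} (R : SetRel (Fin (n + m)) (Fin k)) :
    relCopair ((relInl m n).comp R) ((relInr m n).comp R) = R := by
  ext ⟨x, z⟩
  simp only [SetRel.mem_comp, relInl, relInr, relCopair, Set.mem_ofPred_eq, exists_eq_left]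
  constructor
  · rintro (⟨i, rfl, h⟩ | ⟨i, rfl, h⟩) <;> exact h
  · intro h
    induction x using Fin.addCases with
    | left i => exact Or.inr ⟨i, rfl, h⟩
    | right i => exact Or.inl ⟨i, rfl, h⟩

theorem mem_relMap_iff {m n : ℕ} (R : SetRel (Fin m) (Fin n)) (i : Fin (m + 1))
    (j : Fin (n + 1)) :
    (i, j) ∈ relMap R ↔ (i.val = m ∧ j.val = n) ∨
      ∃ (hi : i.val < m) (hj : j.val < n), ((⟨i.val, hi⟩ : Fin m), (⟨j.val, hj⟩ : Fin n)) ∈ R := by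
  simp only [relMap, Set.mem_ofPred_eq, Fin.ext_iff, Fin.val_last, Fin.val_castSucc]
  refine or_congr Iff.rfl ⟨?_, ?_⟩
  · rintro ⟨i', j', hi, hj, h⟩
    refine ⟨by omega, by omega, ?_⟩
    convert h
  · rintro ⟨hi, hj, h⟩
    exact ⟨_, _, rfl, rfl, h⟩

theorem relMap_id (n : ℕ) : relMap (SetRel.id : SetRel (Fin n) (Fin n)) = SetRel.id := by
  ext ⟨i, j⟩
  simp only [mem_relMap_iff, SetRel.mem_id, Fin.ext_iff]
  constructor
  · rintro (⟨h, h'⟩ | ⟨hi, hj, h⟩) <;> omega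
  · intro h
    by_cases hi : i.val = n
    · exact Or.inl ⟨hi, by omega⟩
    · exact Or.inr ⟨by omega, by omega, h⟩

theorem relMap_comp {m n k : ℕ} (R : SetRel (Fin m) (Fin n)) (S : SetRel (Fin n) (Fin k)) :
    relMap (R.comp S) = (relMap R).comp (relMap S) := by
  ext ⟨i, j⟩
  simp only [mem_relMap_iff, SetRel.mem_comp]
  constructor
  · rintro (⟨h, h'⟩ | ⟨hi, hj, b, h, h'⟩)
    · exact ⟨Fin.last n, Or.inl ⟨h, rfl⟩, Or.inl ⟨rfl, h'⟩⟩
    · exact ⟨b.castSucc, Or.inr ⟨hi, b.isLt, h⟩, Or.inr ⟨b.isLt, hj, h'⟩⟩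
  · rintro ⟨b, ⟨h1, h2⟩ | ⟨h1, h2, h3⟩, ⟨h4, h5⟩ | ⟨h4, h5, h6⟩⟩
    · exact Or.inl ⟨h1, h5⟩
    · omega
    · omega
    · exact Or.inr ⟨h1, h5, _, h3, h6⟩

theorem relEps_nat {m n : ℕ} (R : SetRel (Fin m) (Fin n)) :
    (relMap R).comp (relEps n) = (relEps m).comp R := by
  ext ⟨i, j⟩
  simp only [mem_relMap_iff, SetRel.mem_comp, relEps, Set.mem_ofPred_eq]
  constructor
  · rintro ⟨b, ⟨h1, h2⟩ | ⟨h1, h2, h3⟩, h⟩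
    · omega
    · have e : (⟨b.val, h2⟩ : Fin n) = j := Fin.ext h
      exact ⟨⟨i, h1⟩, rfl, e ▸ h3⟩
  · rintro ⟨b, h, hR⟩
    have e : b = ⟨i.val, by omega⟩ := Fin.ext h.symm
    exact ⟨j.castSucc, Or.inr ⟨by omega, j.isLt, e ▸ hR⟩, rfl⟩

theorem relDelta_nat {m n : ℕ} (R : SetRel (Fin m) (Fin n)) :
    (relMap R).comp (relDelta n) = (relDelta m).comp (relMap (relMap R)) := by
  ext ⟨i, j⟩
  simp only [mem_relMap_iff, SetRel.mem_comp, relDelta, Set.mem_ofPred_eq]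
  constructor
  · rintro ⟨b, ⟨h1, h2⟩ | ⟨h1, h2, h3⟩, h | ⟨h, h'⟩⟩
    · exact ⟨⟨m, by omega⟩, Or.inl h1, Or.inr ⟨by grind, by grind, Or.inl ⟨rfl, by grind⟩⟩⟩
    · exact ⟨⟨m + 1, by omega⟩, Or.inr ⟨h1, rfl⟩, Or.inl ⟨rfl, h'⟩⟩
    · have e : (⟨b.val, h2⟩ : Fin n) = ⟨j.val, by omega⟩ := Fin.ext h
      exact ⟨⟨i, by omega⟩, Or.inl rfl,
        Or.inr ⟨by grind, by grind, Or.inr ⟨h1, by grind, e ▸ h3⟩⟩⟩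
    · omega
  · rintro ⟨b, h | ⟨h, h'⟩, ⟨h1, h2⟩ | ⟨h1, h2, ⟨h3, h4⟩ | ⟨h3, h4, h5⟩⟩⟩
    · omega
    · exact ⟨Fin.last n, Or.inl ⟨by grind, rfl⟩, Or.inl (by grind)⟩
    · have e : (⟨b.val, h3⟩ : Fin m) = ⟨i.val, by grind⟩ := Fin.ext h.symm
      exact ⟨⟨j, by omega⟩, Or.inr ⟨by grind, by grind, e ▸ h5⟩, Or.inl rfl⟩
    · exact ⟨Fin.last n, Or.inl ⟨h, rfl⟩, Or.inr ⟨rfl, h2⟩⟩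
    · omega
    · grind

theorem relDelta_eps (n : ℕ) : (relDelta n).comp (relEps (n + 1)) = SetRel.id := by
  ext ⟨i, j⟩
  simp only [SetRel.mem_comp, relDelta, relEps, Set.mem_ofPred_eq, SetRel.mem_id, Fin.ext_iff]
  constructor
  · rintro ⟨b, h | ⟨h, h'⟩, hb⟩ <;> omega
  · intro h
    exact ⟨i.castSucc, Or.inl rfl, h⟩

theorem relDelta_map_eps (n : ℕ) : (relDelta n).comp (relMap (relEps n)) = SetRel.id := by
  ext ⟨i, j⟩
  simp only [SetRel.mem_comp, relDelta, mem_relMap_iff, relEps, Set.mem_ofPred_eq, SetRel.mem_id,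
    Fin.ext_iff]
  constructor
  · rintro ⟨b, h | ⟨h, h'⟩, ⟨h1, h2⟩ | ⟨h1, h2, h3⟩⟩ <;> omega
  · intro h
    by_cases hi : i.val = n
    · exact ⟨Fin.last (n + 1), Or.inr ⟨hi, rfl⟩, Or.inl ⟨rfl, by omega⟩⟩
    · exact ⟨i.castSucc, Or.inl rfl, Or.inr ⟨by grind, by grind, h⟩⟩

theorem relDelta_delta (n : ℕ) :
    (relDelta n).comp (relDelta (n + 1)) = (relDelta n).comp (relMap (relDelta n)) := by
  ext ⟨i, j⟩
  simp only [SetRel.mem_comp, relDelta, mem_relMap_iff, Set.mem_ofPred_eq]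
  constructor
  · rintro ⟨b, h, hb⟩
    by_cases hj : j.val = n + 2
    · exact ⟨Fin.last (n + 1), Or.inr ⟨by omega, rfl⟩, Or.inl ⟨rfl, hj⟩⟩
    · exact ⟨i.castSucc, Or.inl rfl, Or.inr ⟨by grind, by grind, by grind⟩⟩
  · rintro ⟨b, h, ⟨h1, h2⟩ | ⟨h1, h2, h3⟩⟩
    · exact ⟨Fin.last (n + 1), Or.inr ⟨by omega, rfl⟩, Or.inr ⟨rfl, h2⟩⟩
    · exact ⟨⟨j, by omega⟩, by grind, Or.inl rfl⟩

theorem Term.Eqv.graph_eq {A B : DSco P} {f g : Term A B} (h : Term.Eqv f g) :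
    f.graph = g.graph := by
  induction h with
  | refl f => rfl
  | symm _ ih => exact ih.symm
  | trans _ _ ih₁ ih₂ => exact ih₁.trans ih₂
  | comp_congr _ _ ih₁ ih₂ => exact congrArg₂ SetRel.comp ih₁ ih₂
  | copair_congr _ _ ih₁ ih₂ => exact congrArg₂ relCopair ih₁ ih₂
  | map_congr _ ih => exact congrArg relMap ih
  | id_comp f => exact SetRel.id_comp _
  | comp_id f => exact SetRel.comp_id _
  | assoc f g h => exact SetRel.comp_assoc _ _ _
  | bang_uniq f => exact Set.ext fun x => x.1.elim0
  | inl_copair f g => exact relInl_copair _ _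
  | inr_copair f g => exact relInr_copair _ _
  | copair_eta h => exact relCopair_eta _
  | map_id A => exact relMap_id _
  | map_comp f g => exact relMap_comp _ _
  | eps_nat f => exact relEps_nat _
  | delta_nat f => exact relDelta_nat _
  | delta_eps A => exact relDelta_eps _
  | delta_map_eps A => exact relDelta_map_eps _
  | delta_delta A => exact relDelta_delta _

/-- The functor `G` from `DS^co` to `Rel`. -/
def G (P : Type u) : DSco P ⥤ FinOrdRel where
  obj A := ⟨occ A⟩
  map {A B} (f : Quotient (Term.setoid A B)) :=
    Quotient.lift Term.graph (fun _ _ h => Term.Eqv.graph_eq h) f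
  map_id _ := rfl
  map_comp f g := by
    induction f using Quotient.inductionOn with
    | h f =>
      induction g using Quotient.inductionOn with
      | h g => rfl

/-! ### `G` on the derived arrows

The following facts confirm that `G` joins the expected occurrences on the derived arrows. -/

/-- `G f` and `G g` side by side, `G f` on the left. -/
def relTensor {m n m' n' : ℕ} (R : SetRel (Fin m) (Fin m')) (S : SetRel (Fin n) (Fin n')) :
    SetRel (Fin (n + m)) (Fin (n' + m')) :=
  {x | (∃ i j, x.1 = Fin.natAdd n i ∧ x.2 = Fin.natAdd n' j ∧ (i, j) ∈ R) ∨
    ∃ i j, x.1 = Fin.castAdd m i ∧ x.2 = Fin.castAdd m' j ∧ (i, j) ∈ S}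

theorem G_map_tensorHom {A B A' B' : DSco P} (f : A ⟶ A') (g : B ⟶ B') :
    (G P).map (tensorHom f g) = relTensor ((G P).map f) ((G P).map g) := by
  induction f using Quotient.inductionOn with
  | h f =>
    induction g using Quotient.inductionOn with
    | h g =>
      change relCopair (f.graph.comp (relInl _ _)) (g.graph.comp (relInr _ _)) =
        relTensor f.graph g.graph
      ext ⟨x, y⟩
      simp only [relCopair, relTensor, relInl, relInr, SetRel.mem_comp, Set.mem_ofPred_eq]
      grind

theorem G_map_mapL {A B : DSco P} (f : A ⟶ B) : (G P).map (mapL f) = relMap ((G P).map f) := by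
  induction f using Quotient.inductionOn with
  | h f => rfl

theorem G_map_eps (A : DSco P) : (G P).map (eps A) = relEps (occ A) := rfl

theorem G_map_delta (A : DSco P) : (G P).map (delta A) = relDelta (occ A) := rfl

theorem G_map_bang (A : DSco P) :
    (G P).map (bang A) = (∅ : SetRel (Fin 0) (Fin (occ A))) := rfl

theorem G_map_assocHom (A B C : DSco P) : (G P).map (assocHom A B C) =
    ({x | x.1.val = x.2.val} :
      SetRel (Fin (occ C + (occ B + occ A))) (Fin (occ C + occ B + occ A))) := by
  change relCopair (relCopair (relInl _ _) ((relInl _ _).comp (relInr _ _)))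
    ((relInr _ _).comp (relInr _ _)) = _
  ext ⟨x, y⟩
  simp only [relCopair, relInl, relInr, SetRel.mem_comp, Set.mem_ofPred_eq, Fin.ext_iff,
    Fin.val_natAdd, Fin.val_castAdd]
  constructor
  · rintro (⟨i, h, ⟨k, h1, h2⟩ | ⟨k, h1, b, h2, h3⟩⟩ | ⟨i, h, b, h1, h2⟩) <;> omega
  · intro h
    induction x using Fin.addCases with
    | left i => exact Or.inr ⟨i, rfl, Fin.castAdd _ i, rfl, h.symm⟩
    | right i =>
      rw [Fin.val_natAdd] at h
      refine Or.inl ⟨i, rfl, ?_⟩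
      induction i using Fin.addCases with
      | left i => exact Or.inr ⟨i, rfl, Fin.natAdd _ i, rfl, h.symm⟩
      | right i =>
        rw [Fin.val_natAdd] at h
        exact Or.inl ⟨i, rfl, by omega⟩

theorem G_map_leftUnit (A : DSco P) : (G P).map (leftUnit A) =
    ({x | x.1.val = x.2.val} : SetRel (Fin (occ A + 0)) (Fin (occ A))) := by
  change relCopair ∅ SetRel.id = _
  ext ⟨x, y⟩
  simp only [relCopair, Set.mem_ofPred_eq, SetRel.mem_id, Fin.ext_iff, Fin.val_natAdd,
    Fin.val_castAdd]
  constructor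
  · rintro (⟨i, -⟩ | ⟨i, h, h'⟩)
    · exact i.elim0
    · exact h.trans h'
  · exact fun h => Or.inr ⟨y, h, rfl⟩

theorem G_map_rightUnit (A : DSco P) : (G P).map (rightUnit A) =
    ({x | x.1.val = x.2.val} : SetRel (Fin (0 + occ A)) (Fin (occ A))) := by
  change relCopair SetRel.id ∅ = _
  ext ⟨x, y⟩
  simp only [relCopair, Set.mem_ofPred_eq, SetRel.mem_id, Fin.ext_iff, Fin.val_natAdd,
    Fin.val_castAdd]
  constructor
  · rintro (⟨i, h, h'⟩ | ⟨i, -⟩)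
    · exact (h.trans (Nat.zero_add _)).trans h'
    · exact i.elim0
  · exact fun h => Or.inl ⟨y, h.trans (Nat.zero_add _).symm, rfl⟩

theorem G_map_symmetry (A B : DSco P) : (G P).map (symmetry A B) =
    ({x | (∃ i, x.1 = Fin.natAdd (occ B) i ∧ x.2 = Fin.castAdd (occ B) i) ∨
      ∃ i, x.1 = Fin.castAdd (occ A) i ∧ x.2 = Fin.natAdd (occ A) i} :
      SetRel (Fin (occ B + occ A)) (Fin (occ A + occ B))) := rfl

theorem G_map_codiag (A : DSco P) : (G P).map (codiag A) =
    ({x | x.1 = Fin.natAdd (occ A) x.2 ∨ x.1 = Fin.castAdd (occ A) x.2} :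
      SetRel (Fin (occ A + occ A)) (Fin (occ A))) := by
  change relCopair SetRel.id SetRel.id = _
  ext ⟨x, y⟩
  simp [relCopair]

/-- `G ψ_{A,B}`: both outermost occurrences of `L` in `L A ⊗ L B` are joined with the outermost
`L` of `L (A ⊗ B)`; the occurrences in `A` and in `B` are joined with themselves. -/
theorem G_map_psi (A B : DSco P) : (G P).map (psi A B) =
    ({x | ((x.1 = Fin.natAdd (occ B + 1) (Fin.last (occ A)) ∨
          x.1 = Fin.castAdd (occ A + 1) (Fin.last (occ B))) ∧ x.2 = Fin.last (occ B + occ A)) ∨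
        (∃ i : Fin (occ A), x.1 = Fin.natAdd (occ B + 1) i.castSucc ∧
          x.2 = (Fin.natAdd (occ B) i).castSucc) ∨
        ∃ i : Fin (occ B), x.1 = Fin.castAdd (occ A + 1) i.castSucc ∧
          x.2 = (Fin.castAdd (occ A) i).castSucc} :
      SetRel (Fin (occ B + 1 + (occ A + 1))) (Fin (occ B + occ A + 1))) := by
  have h : psi A B = copair (mapL (inl A B)) (mapL (inr A B)) := by
    rw [← copair_eta (psi A B)]
    unfold psi tensorHom codiag
    rw [← Category.assoc, ← Category.assoc, inl_copair, inr_copair, Category.assoc,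
      Category.assoc, inl_copair, inr_copair, Category.comp_id, Category.comp_id]
  rw [h]
  change relCopair (relMap (relInl _ _)) (relMap (relInr _ _)) = _
  ext ⟨x, y⟩
  simp only [relCopair, relMap, relInl, relInr, Set.mem_ofPred_eq]
  grind

theorem G_map_psi₀ : (G P).map psi₀ = (∅ : SetRel (Fin 0) (Fin 1)) := rfl

end DSco

/-! Every arrow has a normal form, and the normal form can be read off from its relation. Copairing
reduces an arrow to its restrictions to the letters and the `L A` among the summands of the source.
A letter can only be included as a summand. An arrow out of `L A` either discards the outermost `L`
by `ε`, or has the form `extend f ≫ i` with `f : L A ⟶ C` and `i` the inclusion of a summand `L C`.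
Existence is a cut elimination: normal arrows contain the generators and are closed under
composition (`IsNormal.comp`). The induction is on the size of the middle object, then on the left
factor, and, for a cut at `L B`, on the right factor. The two essential reductions are `extend_eps`,
which replaces a cut at `L B` by one at `B`, and `extend_comp_extend`, which moves the cut to a
subterm of the right factor. For uniqueness (`IsNormal.eq_of_rel_eq`), the outermost `L` of `L A` is
joined with something in the `extend` form and with nothing in the `ε` form, so the relation tells
the two apart. Non-`⊗` summands that overlap coincide, so the relation also determines `i`. Summand
inclusions and `ε` can be cancelled in `Rel`, and `extend_eps` recovers the relation of `f`, to
which induction applies. -/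

namespace DSco

variable {P : Type u}

/-! ### Normal forms of arrows -/

/-- The inclusions of a `⊗`-summand: composites of injections. -/
inductive IsSummandIncl {X : DSco P} : ∀ {B : DSco P}, (X ⟶ B) → Prop
  | refl : IsSummandIncl (𝟙 X)
  | inl {A B : DSco P} {i : X ⟶ A} : IsSummandIncl i → IsSummandIncl (i ≫ DSco.inl A B)
  | inr {A B : DSco P} {i : X ⟶ B} : IsSummandIncl i → IsSummandIncl (i ≫ DSco.inr A B)

/-- The extension `δ_A ≫ L f : L A ⟶ L B` of `f : L A ⟶ B`. -/
def extend {A B : DSco P} (f : L A ⟶ B) : L A ⟶ L B := delta A ≫ mapL f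

/-- Arrows in normal form. An arrow out of a letter is the inclusion of a summand; an arrow out of
`L A` factors either through `ε_A` or through the extension of an arrow `L A ⟶ C` to a summand
`L C` of the target. -/
inductive IsNormal : ∀ {A B : DSco P}, (A ⟶ B) → Prop
  | bang (B : DSco P) : IsNormal (DSco.bang B)
  | copair {A B C : DSco P} {f : A ⟶ C} {g : B ⟶ C} :
      IsNormal f → IsNormal g → IsNormal (DSco.copair f g)
  | letter {p : P} {B : DSco P} {i : letter p ⟶ B} : IsSummandIncl i → IsNormal i
  | eps {A B : DSco P} {f : A ⟶ B} : IsNormal f → IsNormal (DSco.eps A ≫ f)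
  | extend {A B C : DSco P} {f : L A ⟶ C} {i : L C ⟶ B} :
      IsNormal f → IsSummandIncl i → IsNormal (DSco.extend f ≫ i)

/-! ### Coproduct equations, and the comonad equations in co-Kleisli form -/

theorem bang_uniq {A : DSco P} (f : (I : DSco P) ⟶ A) : f = bang A :=
  isInitialI.hom_ext _ _

theorem copair_comp {A B C D : DSco P} (f : A ⟶ C) (g : B ⟶ C) (h : C ⟶ D) :
    copair f g ≫ h = copair (f ≫ h) (g ≫ h) := by
  rw [← copair_eta (copair f g ≫ h), ← Category.assoc, ← Category.assoc, inl_copair, inr_copair]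

theorem mapL_eps {A B : DSco P} (f : A ⟶ B) : mapL f ≫ eps B = eps A ≫ f :=
  (comonad P).ε.naturality f

theorem mapL_delta {A B : DSco P} (f : A ⟶ B) :
    mapL f ≫ delta B = delta A ≫ mapL (mapL f) :=
  (comonad P).δ.naturality f

theorem mapL_comp {A B C : DSco P} (f : A ⟶ B) (g : B ⟶ C) :
    mapL (f ≫ g) = mapL f ≫ mapL g :=
  (comonad P).map_comp f g

theorem delta_eps (A : DSco P) : delta A ≫ eps (L A) = 𝟙 (L A) :=
  (comonad P).left_counit A

theorem delta_mapL_eps (A : DSco P) : delta A ≫ mapL (eps A) = 𝟙 (L A) :=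
  (comonad P).right_counit A

theorem delta_delta (A : DSco P) : delta A ≫ delta (L A) = delta A ≫ mapL (delta A) :=
  ((comonad P).coassoc A).symm

theorem extend_eps {A B : DSco P} (f : L A ⟶ B) : extend f ≫ eps B = f := by
  rw [extend, Category.assoc, mapL_eps, ← Category.assoc, delta_eps, Category.id_comp]

theorem extend_counit (A : DSco P) : extend (eps A) = 𝟙 (L A) := delta_mapL_eps A

/-- Associativity of co-Kleisli composition, from naturality of `δ` and coassociativity. It pushes a
composition under `extend`, next to the smaller arrow `g`. -/
theorem extend_comp_extend {A B C : DSco P} (f : L A ⟶ B) (g : L B ⟶ C) :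
    extend f ≫ extend g = extend (extend f ≫ g) := by
  simp only [extend, Category.assoc, mapL_comp]
  rw [← Category.assoc (mapL f), mapL_delta, Category.assoc, ← Category.assoc (delta A),
    delta_delta, Category.assoc]

/-- Brings `mapL f` into normal form once `f` is normal. -/
theorem extend_eps_comp {A B : DSco P} (f : A ⟶ B) : extend (eps A ≫ f) = mapL f := by
  rw [extend, mapL_comp, ← Category.assoc, delta_mapL_eps, Category.id_comp]

theorem IsSummandIncl.sizeOf_le {X B : DSco P} {i : X ⟶ B} (hi : IsSummandIncl i) :
    sizeOf X ≤ sizeOf B := by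
  induction hi with
  | refl => exact le_rfl
  | inl _ ih => simp only [tensor.sizeOf_spec]; omega
  | inr _ ih => simp only [tensor.sizeOf_spec]; omega

/-! ### Closure of normal arrows under composition -/

namespace IsNormal

theorem comp_inl {A B : DSco P} {f : A ⟶ B} (hf : IsNormal f) (C : DSco P) :
    IsNormal (f ≫ inl B C) := by
  induction hf with
  | bang B => rw [bang_uniq (DSco.bang B ≫ _)]; exact .bang _
  | copair _ _ ihf ihg => rw [copair_comp]; exact .copair ihf ihg
  | letter hi => exact .letter hi.inl
  | eps _ ih => rw [Category.assoc]; exact .eps ih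
  | extend hf hi => rw [Category.assoc]; exact .extend hf hi.inl

theorem comp_inr {A B : DSco P} {f : A ⟶ B} (hf : IsNormal f) (C : DSco P) :
    IsNormal (f ≫ inr C B) := by
  induction hf with
  | bang B => rw [bang_uniq (DSco.bang B ≫ _)]; exact .bang _
  | copair _ _ ihf ihg => rw [copair_comp]; exact .copair ihf ihg
  | letter hi => exact .letter hi.inr
  | eps _ ih => rw [Category.assoc]; exact .eps ih
  | extend hf hi => rw [Category.assoc]; exact .extend hf hi.inr

theorem id (A : DSco P) : IsNormal (𝟙 A) := by
  induction A with
  | letter p => exact .letter .refl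
  | I => rw [bang_uniq (𝟙 I)]; exact .bang _
  | tensor A B ihA ihB =>
    rw [← copair_eta (𝟙 (tensor A B)), Category.comp_id, Category.comp_id]
    have hA := ihA.comp_inl B
    have hB := ihB.comp_inr A
    rw [Category.id_comp] at hA hB
    exact .copair hA hB
  | L A ih =>
    have h := (IsNormal.extend (.eps ih) .refl)
    rwa [Category.comp_id, Category.comp_id, extend_counit] at h

theorem counit (A : DSco P) : IsNormal (DSco.eps A) := by
  have h := IsNormal.eps (IsNormal.id A)
  rwa [Category.comp_id] at h

theorem ext {A B : DSco P} {f : L A ⟶ B} (hf : IsNormal f) : IsNormal (DSco.extend f) := by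
  have h := IsNormal.extend hf .refl
  rwa [Category.comp_id] at h

/-- Restricting a normal arrow to a summand gives a normal arrow. -/
theorem incl_comp {X B C : DSco P} {i : X ⟶ B} (hi : IsSummandIncl i) {g : B ⟶ C}
    (hg : IsNormal g) : IsNormal (i ≫ g) := by
  induction hi with
  | refl => rwa [Category.id_comp]
  | inl _ ih =>
    cases hg with
    | copair hf hg => rw [Category.assoc, inl_copair]; exact ih hf
  | inr _ ih =>
    cases hg with
    | copair hf hg => rw [Category.assoc, inr_copair]; exact ih hg

/-- The extension of `f : L A ⟶ B` can be composed with any normal arrow out of `L B`, provided `f`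
can be composed with any normal arrow out of `B`. -/
theorem extend_comp {A B X C : DSco P} {f : L A ⟶ B}
    (ih : ∀ {D : DSco P} {h : B ⟶ D}, IsNormal h → IsNormal (f ≫ h))
    {g : X ⟶ C} (hg : IsNormal g) (hX : X = L B) :
    IsNormal (DSco.extend f ≫ eqToHom hX.symm ≫ g) := by
  -- The source of `g` is a variable `X` with `X = L B`, so that the induction has a free index. The
  -- first three constructors have a source not of the form `L B`.
  induction hg with
  | bang => cases hX
  | copair => cases hX
  | letter => cases hX
  | eps hg =>
    cases hX
    rw [eqToHom_refl, Category.id_comp, ← Category.assoc, extend_eps]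
    exact ih hg
  | extend hg hi ihg =>
    cases hX
    -- The arrow under the second `extend` again has source `L B`, so the cut at `L B` moves to a
    -- subterm of `g`.
    have h := ihg rfl
    rw [eqToHom_refl, Category.id_comp] at h ⊢
    rw [← Category.assoc, extend_comp_extend]
    exact .extend h hi

/-- The cut at `L B`, given composition through the smaller object `B`. -/
theorem comp_of_L {A B C : DSco P}
    (ih : ∀ {A C : DSco P} {f : A ⟶ B} {g : B ⟶ C}, IsNormal f → IsNormal g → IsNormal (f ≫ g))
    {f : L A ⟶ B} (hf : IsNormal f) {g : L B ⟶ C} (hg : IsNormal g) :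
    IsNormal (DSco.extend f ≫ g) := by
  have h := extend_comp (fun hh => ih hf hh) hg rfl
  rwa [eqToHom_refl, Category.id_comp] at h

theorem comp_of_sizeOf_le (n : ℕ) {A B C : DSco P} (hB : sizeOf B ≤ n) {f : A ⟶ B} {g : B ⟶ C}
    (hf : IsNormal f) (hg : IsNormal g) : IsNormal (f ≫ g) := by
  induction n generalizing A B C with
  | zero => cases B <;> simp at hB
  | succ n ih =>
    induction hf with
    | bang B => rw [bang_uniq (DSco.bang B ≫ g)]; exact .bang _
    | copair _ _ ihf ihg => rw [copair_comp]; exact .copair (ihf hB hg) (ihg hB hg)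
    | letter hi => exact incl_comp hi hg
    | eps _ ihf => rw [Category.assoc]; exact .eps (ihf hB hg)
    | extend hf hi =>
      rw [Category.assoc]
      -- The cut is now at a summand `L C` of the middle object, so `C` is strictly smaller than
      -- that object and the outer induction covers it.
      have hs := hi.sizeOf_le
      rw [L.sizeOf_spec] at hs
      exact comp_of_L (fun hf hg => ih (by omega) hf hg) hf (incl_comp hi hg)

theorem comp {A B C : DSco P} {f : A ⟶ B} {g : B ⟶ C} (hf : IsNormal f) (hg : IsNormal g) :
    IsNormal (f ≫ g) :=
  comp_of_sizeOf_le _ le_rfl hf hg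

theorem of_term {A B : DSco P} (t : Term A B) : IsNormal (⟦t⟧ : Quotient (Term.setoid A B)) := by
  induction t with
  | id A => exact IsNormal.id A
  | comp f g ihf ihg => exact ihf.comp ihg
  | bang A => exact .bang A
  | inl A B =>
    have h := (IsNormal.id A).comp_inl B
    rwa [Category.id_comp] at h
  | inr A B =>
    have h := (IsNormal.id B).comp_inr A
    rwa [Category.id_comp] at h
  | copair f g ihf ihg => exact .copair ihf ihg
  | @map A B f ih =>
    have h := (IsNormal.eps ih).ext
    rwa [extend_eps_comp] at h
  | eps A => exact counit A
  | delta A =>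
    have h := (IsNormal.id (L A)).ext
    rwa [DSco.extend, show mapL (𝟙 (L A)) = 𝟙 _ from (comonad P).map_id (L A),
      Category.comp_id] at h

end IsNormal

/-- Every arrow has a normal form. -/
theorem isNormal {A B : DSco P} (f : A ⟶ B) : IsNormal f := by
  induction f using Quotient.inductionOn with
  | h f => exact IsNormal.of_term f

/-! ### The relations of normal forms -/

/-- The relation `G f` between the occurrences in `A` and in `B`. -/
def rel {A B : DSco P} (f : A ⟶ B) : SetRel (Fin (occ A)) (Fin (occ B)) := (G P).map f

theorem rel_comp {A B C : DSco P} (f : A ⟶ B) (g : B ⟶ C) :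
    rel (f ≫ g) = (rel f).comp (rel g) :=
  (G P).map_comp f g

theorem rel_comp_congr {A B C : DSco P} {f g : A ⟶ B} (h : rel f = rel g) (k : B ⟶ C) :
    rel (f ≫ k) = rel (g ≫ k) := by
  rw [rel_comp, rel_comp, h]

theorem comp_rel_congr {A B C : DSco P} {f g : B ⟶ C} (h : rel f = rel g) (k : A ⟶ B) :
    rel (k ≫ f) = rel (k ≫ g) := by
  rw [rel_comp, rel_comp, h]

theorem rel_mapL {A B : DSco P} (f : A ⟶ B) : rel (mapL f) = relMap (rel f) := G_map_mapL f

theorem last_mem_rel_extend {A B : DSco P} (f : L A ⟶ B) :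
    (Fin.last (occ A), Fin.last (occ B)) ∈ rel (extend f) := by
  rw [extend, rel_comp, rel_mapL]
  -- Of the two copies of `L` made by `δ`, the outermost one, numbered `occ A + 1`, is followed;
  -- `mapL f` preserves it.
  exact ⟨Fin.last (occ A + 1), Or.inr ⟨rfl, rfl⟩, Or.inl ⟨rfl, rfl⟩⟩

theorem last_notMem_rel_eps_comp {A B : DSco P} (f : A ⟶ B) (c : Fin (occ B)) :
    (Fin.last (occ A), c) ∉ rel (eps A ≫ f) := by
  rw [rel_comp]
  rintro ⟨b, hb, -⟩
  have h : occ A = b.val := hb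
  exact absurd b.isLt (by omega)

/-- In `Rel` the relation of `ε` has a section `S`, sending each occurrence in `A` to its copy in `L
A`; hence it cancels on the left. -/
theorem rel_of_rel_eps_comp {A B : DSco P} {f g : A ⟶ B} (h : rel (eps A ≫ f) = rel (eps A ≫ g)) :
    rel f = rel g := by
  let S : SetRel (Fin (occ A)) (Fin (occ (L A))) := {x | x.1.val = x.2.val}
  have hs : S.comp (rel (eps A)) = SetRel.id := by
    ext ⟨i, j⟩
    constructor
    · rintro ⟨b, hb, h⟩
      exact Fin.ext (Eq.trans hb h)
    · intro e
      cases e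
      exact ⟨i.castSucc, rfl, rfl⟩
  rw [rel_comp, rel_comp] at h
  rw [← SetRel.id_comp (rel f), ← SetRel.id_comp (rel g), ← hs, SetRel.comp_assoc, h,
    SetRel.comp_assoc]

/-! ### Summand inclusions in `Rel`: cancellation and disjointness -/

namespace IsSummandIncl

/-- The relation of a summand inclusion has a one-sided inverse. -/
theorem exists_rel_comp_eq_id {X B : DSco P} {i : X ⟶ B} (hi : IsSummandIncl i) :
    ∃ S : SetRel (Fin (occ B)) (Fin (occ X)), (rel i).comp S = SetRel.id := by
  induction hi with
  | refl => exact ⟨SetRel.id, SetRel.comp_id _⟩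
  | @inl A B i _ ih =>
    obtain ⟨S, hS⟩ := ih
    -- The inverse on the old block, with nothing joined on the new one.
    let T : SetRel (Fin (occ (tensor A B))) (Fin (occ X)) :=
      relCopair S (∅ : SetRel (Fin (occ B)) (Fin (occ X)))
    refine ⟨T, ?_⟩
    rw [rel_comp, SetRel.comp_assoc]
    exact (congrArg _ (relInl_copair _ _)).trans hS
  | @inr A B i _ ih =>
    obtain ⟨S, hS⟩ := ih
    let T : SetRel (Fin (occ (tensor A B))) (Fin (occ X)) :=
      relCopair (∅ : SetRel (Fin (occ A)) (Fin (occ X))) S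
    refine ⟨T, ?_⟩
    rw [rel_comp, SetRel.comp_assoc]
    exact (congrArg _ (relInr_copair _ _)).trans hS

theorem rel_of_rel_comp {A X B : DSco P} {i : X ⟶ B} (hi : IsSummandIncl i) {f g : A ⟶ X}
    (h : rel (f ≫ i) = rel (g ≫ i)) : rel f = rel g := by
  obtain ⟨S, hS⟩ := hi.exists_rel_comp_eq_id
  rw [rel_comp, rel_comp] at h
  rw [← SetRel.comp_id (rel f), ← SetRel.comp_id (rel g), ← hS, ← SetRel.comp_assoc, h,
    SetRel.comp_assoc]

theorem exists_mem_rel {X B : DSco P} {i : X ⟶ B} (hi : IsSummandIncl i) (a : Fin (occ X)) :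
    ∃ c, (a, c) ∈ rel i := by
  obtain ⟨S, hS⟩ := hi.exists_rel_comp_eq_id
  have h : (a, a) ∈ (rel i).comp S := by rw [hS]; rfl
  obtain ⟨c, hc, -⟩ := h
  exact ⟨c, hc⟩

/-- Two summands that are not themselves of the form `A ⊗ B` are equal as soon as they overlap. -/
theorem heq_of_mem_rel {X Y B : DSco P} (hX : ∀ A C, X ≠ tensor A C) (hY : ∀ A C, Y ≠ tensor A C)
    {i : X ⟶ B} {j : Y ⟶ B} (hi : IsSummandIncl i) (hj : IsSummandIncl j)
    {a : Fin (occ X)} {b : Fin (occ Y)} {c : Fin (occ B)}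
    (ha : (a, c) ∈ rel i) (hb : (b, c) ∈ rel j) : X = Y ∧ i ≍ j := by
  -- Inclusions ending in the same injection reduce to the inductive hypothesis; those ending in
  -- different injections have disjoint images. A summand `I` needs no exclusion, having no
  -- occurrences.
  induction hi with
  | refl =>
    cases hj with
    | refl => exact ⟨rfl, HEq.rfl⟩
    | inl => exact absurd rfl (hX _ _)
    | inr => exact absurd rfl (hX _ _)
  | inl _ ih =>
    rw [rel_comp] at ha
    obtain ⟨a', ha, h⟩ := ha
    cases hj with
    | refl => exact absurd rfl (hY _ _)
    | inl hj =>
      rw [rel_comp] at hb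
      obtain ⟨b', hb, h'⟩ := hb
      have e : a' = b' := Fin.natAdd_injective _ _ (Eq.trans (Eq.symm h) h')
      subst e
      obtain ⟨rfl, h⟩ := ih hj ha hb
      rw [eq_of_heq h]
      exact ⟨rfl, HEq.rfl⟩
    | inr hj =>
      rw [rel_comp] at hb
      obtain ⟨b', hb, h'⟩ := hb
      have e := congrArg Fin.val (Eq.trans (Eq.symm h) h')
      simp only [Fin.val_natAdd, Fin.val_castAdd] at e
      omega
  | inr _ ih =>
    rw [rel_comp] at ha
    obtain ⟨a', ha, h⟩ := ha
    cases hj with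
    | refl => exact absurd rfl (hY _ _)
    | inr hj =>
      rw [rel_comp] at hb
      obtain ⟨b', hb, h'⟩ := hb
      have e : a' = b' := Fin.castAdd_injective _ _ (Eq.trans (Eq.symm h) h')
      subst e
      obtain ⟨rfl, h⟩ := ih hj ha hb
      rw [eq_of_heq h]
      exact ⟨rfl, HEq.rfl⟩
    | inl hj =>
      rw [rel_comp] at hb
      obtain ⟨b', hb, h'⟩ := hb
      have e := congrArg Fin.val (Eq.trans (Eq.symm h) h')
      simp only [Fin.val_natAdd, Fin.val_castAdd] at e
      omega

end IsSummandIncl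

/-- Normal arrows with the same relation are equal. -/
theorem IsNormal.eq_of_rel_eq {A B : DSco P} {f g : A ⟶ B} (hf : IsNormal f) (hg : IsNormal g)
    (h : rel f = rel g) : f = g := by
  induction hf with
  | bang B => exact (bang_uniq g).symm
  | copair _ _ ihf ihg =>
    cases hg with
    | copair hf' hg' =>
      have h₁ := comp_rel_congr h (inl _ _)
      have h₂ := comp_rel_congr h (inr _ _)
      rw [inl_copair, inl_copair] at h₁
      rw [inr_copair, inr_copair] at h₂
      rw [ihf hf' h₁, ihg hg' h₂]
  | letter hi =>
    cases hg with
    | letter hj =>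
      -- A letter has a single occurrence, `0`; its image lies in both summands.
      obtain ⟨c, hc⟩ := hi.exists_mem_rel (0 : Fin 1)
      exact eq_of_heq (hi.heq_of_mem_rel (by simp) (by simp) hj hc (h ▸ hc)).2
  | @eps A B f hf ih =>
    cases hg with
    | eps hg => rw [ih hg (rel_of_rel_eps_comp h)]
    | @extend _ _ C k j hk hj =>
      obtain ⟨c, hc⟩ := hj.exists_mem_rel (Fin.last (occ C))
      refine absurd ?_ (last_notMem_rel_eps_comp f c)
      rw [h, rel_comp]
      exact ⟨_, last_mem_rel_extend k, hc⟩
  | @extend A B C f i hf hi ih =>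
    -- The image `c` of the outermost `L` of `L C` is joined with that of `L A`. This excludes the
    -- `ε` form for `g` and makes the two target summands overlap at `c`.
    obtain ⟨c, hc⟩ := hi.exists_mem_rel (Fin.last (occ C))
    have hl : (Fin.last (occ A), c) ∈ rel (DSco.extend f ≫ i) := by
      rw [rel_comp]
      exact ⟨_, last_mem_rel_extend f, hc⟩
    rw [h] at hl
    cases hg with
    | eps hg => exact absurd hl (last_notMem_rel_eps_comp _ c)
    | @extend _ _ D k j hk hj =>
      rw [rel_comp] at hl
      obtain ⟨b, -, hb⟩ := hl
      obtain ⟨e, hij⟩ := hi.heq_of_mem_rel (by simp) (by simp) hj hc hb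
      cases e
      cases hij
      -- Cancelling the inclusion and composing with `ε` turns equality for the extensions into
      -- equality for `f` and `k`.
      have h' := rel_comp_congr (hi.rel_of_rel_comp h) (DSco.eps C)
      rw [extend_eps, extend_eps] at h'
      rw [ih hk h']

end DSco

/-- The functor `G` from the free cocartesian monoidal comonad `DS^co` on a set `P` of objects to
`Rel` is faithful: arrows `f, g : A ⟶ B` with `G f = G g` are equal. -/
theorem mainTheorem8 (P : Type u) : (DSco.G P).Faithful where
  map_injective h := (DSco.isNormal _).eq_of_rel_eq (DSco.isNormal _) h
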